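/- Let $b_1,b_2,b_3,b_4\in\mathbb R$ with $b_1>0$, $b_3>0$, let $s\ge 1$ and $m,q\ge 0$ be integers, and consider the planar system $\dot x=F(x)$ on $\mathbb R^2$ with $$F(x)=\begin{pmatrix}0&1\\ b_1&b_2\end{pmatrix}x+\begin{pmatrix}0\\ -b_3x_1^{2s+1}+b_4x_1^{2m}x_2^{2q+1}\end{pmatrix}.$$ Let $\Omega=\{x\in\mathbb R^2 : b_2+b_4(2q+1)x_1^{2m}x_2^{2q}<0\}$ be its 2-contraction region, i.e. the set where the second additive compound (the trace) of the Jacobian of $F$ is negative, and let $\Omega_0=\{x\in\mathbb R^2 : b_2+b_4(2q+1)x_1^{2m}x_2^{2q}=0\}$. Suppose that $\Omega\neq\emptyset$ and that there is a counterclockwise oriented simple closed curve $C$, passing through no equilibrium point, whose Poincaré index is $I_C(F)=+1$, where $I_C(F)$ is $\frac1{2\pi}$ times the net change of the angle of $F$ along $C$. Let $$E(x)=\tfrac12x_2^2-\tfrac{b_1}{2}x_1^2+\tfrac{b_3}{2s+2}x_1^{2s+2},\qquad \mathcal U=\{x\in\mathbb R^2: E(x)<r\},$$ where $r\in\mathbb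 R$ is such that the derivative of $E$ along the system satisfies $\dot E(x)=\nabla E(x)\cdot F(x)\le 0$ for all $x\in\mathcal U$. Put $\mathcal D_0=\Omega\cap\mathcal U$. Then: 1. $\mathcal D_0$ is open, every point of $\mathcal D_0$ is the initial value of a solution defined for all $t\ge 0$, and every solution $x:[0,\infty)\to\mathbb R^2$ with $x(0)\in\mathcal D_0$ converges, as $t\to\infty$, to one of the equilibrium points of the system, and this equilibrium point is isolated. 2. If moreover no equilibrium point of the system lies on $\Omega_0$, then $\mathcal D_0$ is a common basin of attraction: every solution as in 1 converges to an isolated equilibrium point that lies in $\mathcal D_0$. -/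

import Mathlib

open Set Filter Topology

namespace PlanarBOA

/-! ### Autonomous planar systems -/

/-- `x` is a trajectory (solution on `[0, ∞)`) of the autonomous system `x' = F x`;
at time `0` the derivative is one-sided. -/
def IsTrajectory (F : ℝ × ℝ → ℝ × ℝ) (x : ℝ → ℝ × ℝ) : Prop :=
  ∀ t : ℝ, 0 ≤ t → HasDerivWithinAt x (F (x t)) (Ici 0) t

/-- Isolated equilibrium points of `x' = F x`. -/
def isolatedEquilibria (F : ℝ × ℝ → ℝ × ℝ) : Set (ℝ × ℝ) :=
  {z | F z = 0 ∧ ∀ᶠ y in 𝓝[≠] z, F y ≠ 0}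

/-- Every point of `D` is the initial value of a trajectory defined for all `t ≥ 0`, and
every trajectory that starts in `D` converges, as `t → ∞`, to one of the points of `S`. -/
def ConvergesFrom (F : ℝ × ℝ → ℝ × ℝ) (D S : Set (ℝ × ℝ)) : Prop :=
  ∀ x₀ ∈ D,
    (∃ x : ℝ → ℝ × ℝ, IsTrajectory F x ∧ x 0 = x₀) ∧
    ∀ x : ℝ → ℝ × ℝ, IsTrajectory F x → x 0 = x₀ → ∃ z ∈ S, Tendsto x atTop (𝓝 z)

/-- Common basin of attraction: an open set `D` such that every trajectory starting in `D`
converges to one of the isolated equilibrium points in `D`. -/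
def IsCommonBOA (F : ℝ × ℝ → ℝ × ℝ) (D : Set (ℝ × ℝ)) : Prop :=
  IsOpen D ∧ ConvergesFrom F D (isolatedEquilibria F ∩ D)

/-- The derivative `dE/dt` of `E` along the trajectories of `x' = F x`, at the point `x`. -/
noncomputable def orbitalDeriv (F : ℝ × ℝ → ℝ × ℝ) (E : ℝ × ℝ → ℝ) (x : ℝ × ℝ) : ℝ :=
  fderiv ℝ E x (F x)

/-! ### Simple closed curves and the Poincaré index -/

/-- `γ`, restricted to `[0, 1]`, parametrizes a simple closed curve. -/
def IsSimpleClosedCurve (γ : ℝ → ℝ × ℝ) : Prop :=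
  ContinuousOn γ (Icc 0 1) ∧ γ 0 = γ 1 ∧ InjOn γ (Ico 0 1)

/-- The planar vector `v t` is nonzero for `t ∈ [0, 1]`, and the net change of a continuous
angle `Φ` of it, from `t = 0` to `t = 1`, is `2 π n`. -/
def HasWinding (v : ℝ → ℝ × ℝ) (n : ℤ) : Prop :=
  ∃ Φ : ℝ → ℝ, ContinuousOn Φ (Icc 0 1) ∧
    (∀ t ∈ Icc (0 : ℝ) 1, ∃ ρ : ℝ, 0 < ρ ∧ v t = (ρ * Real.cos (Φ t), ρ * Real.sin (Φ t))) ∧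
    Φ 1 - Φ 0 = 2 * Real.pi * n

/-- A simple closed curve is counterclockwise if it winds once around some point. -/
def IsCounterclockwise (γ : ℝ → ℝ × ℝ) : Prop :=
  ∃ p : ℝ × ℝ, HasWinding (fun t => γ t - p) 1

/-- The curve `γ` avoids the equilibria of `F` and the Poincaré index of `F` along `γ` is `n`. -/
def HasIndex (F : ℝ × ℝ → ℝ × ℝ) (γ : ℝ → ℝ × ℝ) (n : ℤ) : Prop :=
  HasWinding (fun t => F (γ t)) n

/-! ### 2-contraction regions of planar systems -/

/-- Jacobian matrix of a planar vector field. -/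
noncomputable def jacobian (F : ℝ × ℝ → ℝ × ℝ) (x : ℝ × ℝ) : Matrix (Fin 2) (Fin 2) ℝ :=
  !![(fderiv ℝ F x (1, 0)).1, (fderiv ℝ F x (0, 1)).1;
     (fderiv ℝ F x (1, 0)).2, (fderiv ℝ F x (0, 1)).2]

/-- Second additive compound `J^[2]` of a `2 × 2` matrix: the derivative at `ε = 0` of the second
multiplicative compound of `I + ε J`. For `2 × 2` matrices the latter is the determinant, and
the former is a scalar. -/
noncomputable def additiveCompoundTwo (J : Matrix (Fin 2) (Fin 2) ℝ) : ℝ :=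
  deriv (fun ε : ℝ => (1 + ε • J).det) 0

/-- The points at which the matrix measure `μ(J^[2]) = lim_{ε → 0+} (|1 + ε J^[2]| - 1) / ε` of the
second additive compound of the Jacobian is negative. -/
def twoContractionRegion (F : ℝ × ℝ → ℝ × ℝ) : Set (ℝ × ℝ) :=
  {x | ∃ μ : ℝ, μ < 0 ∧
    Tendsto (fun ε : ℝ => (|1 + ε * additiveCompoundTwo (jacobian F x)| - 1) / ε)
      (𝓝[>] 0) (𝓝 μ)}

/-! ### The class of systems -/

/-- The vector field `A x + f(x)`, with linear part `A = [[0, 1], [b₁, b₂]]` and nonlinear part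
`f(x) = (0, -b₃ x₁^(2s+1) + b₄ x₁^(2m) x₂^(2q+1))`. -/
def field (b₁ b₂ b₃ b₄ : ℝ) (s m q : ℕ) (x : ℝ × ℝ) : ℝ × ℝ :=
  (x.2, b₁ * x.1 + b₂ * x.2
    + (-b₃ * x.1 ^ (2 * s + 1) + b₄ * x.1 ^ (2 * m) * x.2 ^ (2 * q + 1)))

/-- The 2-contraction region of `field b₁ b₂ b₃ b₄ s m q`
(see `Omega_eq_twoContractionRegion`). -/
def Omega (b₂ b₄ : ℝ) (m q : ℕ) : Set (ℝ × ℝ) :=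
  {x | b₂ + b₄ * (2 * q + 1) * x.1 ^ (2 * m) * x.2 ^ (2 * q) < 0}

/-- The set where the trace of the Jacobian vanishes. -/
def OmegaZero (b₂ b₄ : ℝ) (m q : ℕ) : Set (ℝ × ℝ) :=
  {x | b₂ + b₄ * (2 * q + 1) * x.1 ^ (2 * m) * x.2 ^ (2 * q) = 0}

/-- The energy function. -/
noncomputable def energy (b₁ b₃ : ℝ) (s : ℕ) (x : ℝ × ℝ) : ℝ :=
  1 / 2 * x.2 ^ 2 - b₁ / 2 * x.1 ^ 2 + b₃ / (2 * s + 2) * x.1 ^ (2 * s + 2)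

/-- The strict sublevel set `{E < r}` of the energy. -/
def sublevel (b₁ b₃ : ℝ) (s : ℕ) (r : ℝ) : Set (ℝ × ℝ) :=
  {x | energy b₁ b₃ s x < r}

theorem additiveCompoundTwo_eq_trace (J : Matrix (Fin 2) (Fin 2) ℝ) :
    additiveCompoundTwo J = J.trace := by
  have h : (fun ε : ℝ => (1 + ε • J).det)
      = fun ε => 1 + J.trace * ε + J.det * ε ^ 2 := by
    funext ε
    simp [Matrix.det_fin_two, Matrix.trace_fin_two]
    ring
  have hd : HasDerivAt (fun ε : ℝ => 1 + J.trace * ε + J.det * ε ^ 2)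
      (J.trace * 1 + J.det * ((2 : ℕ) * (0 : ℝ) ^ (2 - 1) * 1)) 0 :=
    (((hasDerivAt_id (0 : ℝ)).const_mul J.trace).const_add 1).add
      (((hasDerivAt_id (0 : ℝ)).pow 2).const_mul J.det)
  rw [additiveCompoundTwo, h, hd.deriv]
  simp

theorem tendsto_scalar_measure (a : ℝ) :
    Tendsto (fun ε : ℝ => (|1 + ε * a| - 1) / ε) (𝓝[>] 0) (𝓝 a) := by
  have hc : ContinuousAt (fun ε : ℝ => 1 + ε * a) 0 := by fun_prop
  have hpos : ∀ᶠ ε : ℝ in 𝓝[>] 0, 0 < 1 + ε * a :=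
    (hc.eventually (lt_mem_nhds (a := 0) (by simp))).filter_mono nhdsWithin_le_nhds
  refine tendsto_const_nhds.congr' ?_
  filter_upwards [hpos, self_mem_nhdsWithin] with ε h1 h2
  have h3 : ε ≠ 0 := ne_of_gt h2
  rw [abs_of_pos h1]
  field_simp
  ring

/-- `Omega` is the 2-contraction region of the system. -/
theorem Omega_eq_twoContractionRegion (b₁ b₂ b₃ b₄ : ℝ) (s m q : ℕ) :
    Omega b₂ b₄ m q = twoContractionRegion (field b₁ b₂ b₃ b₄ s m q) := by
  ext x
  have hfst : HasFDerivAt (fun y : ℝ × ℝ => y.1) (ContinuousLinearMap.fst ℝ ℝ ℝ) x :=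
    hasFDerivAt_fst
  have hsnd : HasFDerivAt (fun y : ℝ × ℝ => y.2) (ContinuousLinearMap.snd ℝ ℝ ℝ) x :=
    hasFDerivAt_snd
  have hF : HasFDerivAt (field b₁ b₂ b₃ b₄ s m q) _ x :=
    hsnd.prodMk (((hfst.const_mul b₁).add (hsnd.const_mul b₂)).add
      (((hfst.pow (2 * s + 1)).const_mul (-b₃)).add
        (((hfst.pow (2 * m)).const_mul b₄).mul (hsnd.pow (2 * q + 1)))))
  have htr : additiveCompoundTwo (jacobian (field b₁ b₂ b₃ b₄ s m q) x)
      = b₂ + b₄ * (2 * q + 1) * x.1 ^ (2 * m) * x.2 ^ (2 * q) := by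
    rw [additiveCompoundTwo_eq_trace, Matrix.trace_fin_two, jacobian, hF.fderiv]
    simp
    ring
  constructor
  · intro hx
    exact ⟨_, hx, by rw [htr]; exact tendsto_scalar_measure _⟩
  · rintro ⟨μ, hμ, hlim⟩
    rw [htr] at hlim
    rw [tendsto_nhds_unique hlim (tendsto_scalar_measure _)] at hμ
    exact hμ

end PlanarBOA

namespace PlanarBOA

open scoped NNReal

/-! ### Trajectories and functions along them -/

/-! The energy satisfies `Ė = x₂² g` with damping factor `g = b₂ + b₄ x₁^(2m) x₂^(2q)`. The set `{E
< r}` is bounded and forward invariant, which gives global solutions and a limit of `E` along each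
of them. By Barbalat's lemma, `Ė → 0`.

Since `g ≤ 0` on the open set `{E < r}` and `Ω` is nonempty, `g` vanishes there only on the axes
(`fst_mul_snd_eq_zero_of_damping_eq_zero`), so every cluster point satisfies `x₁ x₂ = 0`. Instead of
LaSalle's invariance principle, Barbalat is applied again, to `W = x₁ x₂ → 0`: cluster points
satisfy `x₂² + x₁ F₂ = 0`, which together with `x₁ x₂ = 0` makes them equilibria. These are finite
in number, so the solution converges to one of them.

Equilibria have `x₂ = 0`, where `g` equals the trace; if the trace is nonzero there, `g ≤ 0` puts
the limit in `Ω`. -/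

theorem IsTrajectory.continuousOn {F : ℝ × ℝ → ℝ × ℝ} {x : ℝ → ℝ × ℝ} (hx : IsTrajectory F x) :
    ContinuousOn x (Ici 0) :=
  fun t ht => (hx t ht).continuousWithinAt

theorem IsTrajectory.hasDerivWithinAt_comp {F : ℝ × ℝ → ℝ × ℝ} {x : ℝ → ℝ × ℝ}
    (hx : IsTrajectory F x) {V : ℝ × ℝ → ℝ} (hV : Differentiable ℝ V) {t : ℝ} (ht : 0 ≤ t) :
    HasDerivWithinAt (fun u => V (x u)) (orbitalDeriv F V (x t)) (Ici 0) t :=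
  (hV (x t)).hasFDerivAt.comp_hasDerivWithinAt t (hx t ht)

/-- Strict sublevel sets on which `V` does not increase along trajectories are invariant. -/
theorem IsTrajectory.lt_of_orbitalDeriv_nonpos {F : ℝ × ℝ → ℝ × ℝ} {x : ℝ → ℝ × ℝ}
    (hx : IsTrajectory F x) {V : ℝ × ℝ → ℝ} (hV : Differentiable ℝ V) {r : ℝ}
    (hdec : ∀ p, V p < r → orbitalDeriv F V p ≤ 0) (h0 : V (x 0) < r) {t : ℝ} (ht : 0 ≤ t) :
    V (x t) < r := by
  -- The barrier `V (x 0) + ε u` stays below `r` up to time `t`, so `hdec` applies wherever `V (x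
  -- u)` touches it.
  obtain ⟨ε, hε, hεt⟩ : ∃ ε : ℝ, 0 < ε ∧ ε * t < r - V (x 0) := by
    refine ⟨(r - V (x 0)) / (t + 1), div_pos (by linarith) (by linarith), ?_⟩
    rw [div_mul_eq_mul_div, div_lt_iff₀ (by linarith)]
    nlinarith
  have hle := image_le_of_deriv_right_lt_deriv_boundary (a := 0) (b := t)
    (f := fun u => V (x u)) (f' := fun u => orbitalDeriv F V (x u))
    (B := fun u => V (x 0) + ε * u) (B' := fun _ => ε)
    (fun u hu => ((hx.hasDerivWithinAt_comp hV hu.1).continuousWithinAt).mono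
      Icc_subset_Ici_self)
    (fun u hu => (hx.hasDerivWithinAt_comp hV hu.1).mono (Ici_subset_Ici.2 hu.1))
    (by simp)
    (fun u => by simpa using ((hasDerivAt_id u).const_mul ε).const_add (V (x 0)))
    (fun u hu h => (hdec _ (by
      have : ε * u ≤ ε * t := mul_le_mul_of_nonneg_left hu.2.le hε.le
      linarith)).trans_lt hε)
    (right_mem_Icc.2 ht)
  linarith

theorem IsTrajectory.antitoneOn_of_orbitalDeriv_nonpos {F : ℝ × ℝ → ℝ × ℝ} {x : ℝ → ℝ × ℝ}
    (hx : IsTrajectory F x) {V : ℝ × ℝ → ℝ} (hV : Differentiable ℝ V)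
    (hdec : ∀ t, 0 ≤ t → orbitalDeriv F V (x t) ≤ 0) :
    AntitoneOn (fun t => V (x t)) (Ici 0) := by
  have hd : ∀ t ∈ interior (Ici (0 : ℝ)),
      HasDerivAt (fun u => V (x u)) (orbitalDeriv F V (x t)) t := by
    intro t ht
    rw [interior_Ici] at ht
    exact (hx.hasDerivWithinAt_comp hV (le_of_lt ht)).hasDerivAt (Ici_mem_nhds ht)
  refine antitoneOn_of_deriv_nonpos (convex_Ici 0)
    (fun t ht => (hx.hasDerivWithinAt_comp hV ht).continuousWithinAt)
    (fun t ht => (hd t ht).differentiableAt.differentiableWithinAt) fun t ht => ?_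
  rw [(hd t ht).deriv]
  exact hdec t (interior_subset ht)

/-! ### Global existence -/

/-- A bounded Lipschitz vector field has a trajectory through every point. -/
theorem exists_isTrajectory_of_lipschitzWith {G : ℝ × ℝ → ℝ × ℝ} {K L : ℝ≥0}
    (hG : LipschitzWith K G) (hb : ∀ p, ‖G p‖ ≤ L) (x₀ : ℝ × ℝ) :
    ∃ x, IsTrajectory G x ∧ x 0 = x₀ := by
  have hloc : ∀ n : ℕ, ∃ α : ℝ → ℝ × ℝ, α 0 = x₀ ∧
      ∀ t ∈ Icc (0 : ℝ) n, HasDerivWithinAt α (G (α t)) (Icc (0 : ℝ) n) t := by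
    intro n
    -- The global bound `L` allows a ball of radius `L * n`, so no time interval is too long.
    have hpl : IsPicardLindelof (fun _ => G) (tmin := 0) (tmax := (n : ℝ))
        ⟨0, left_mem_Icc.2 n.cast_nonneg⟩ x₀ (L * n) 0 L K :=
      IsPicardLindelof.of_time_independent (fun p _ => hb p) hG.lipschitzOnWith (by simp)
    exact hpl.exists_eq_forall_mem_Icc_hasDerivWithinAt₀
  choose α hα0 hα using hloc
  have heq : ∀ m n : ℕ, m ≤ n → EqOn (α m) (α n) (Icc 0 m) := by
    intro m n hmn
    have hsub : Icc (0 : ℝ) m ⊆ Icc 0 n := Icc_subset_Icc_right (by exact_mod_cast hmn)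
    have hright : ∀ k : ℕ, m ≤ k → ∀ t ∈ Ico (0 : ℝ) m,
        HasDerivWithinAt (α k) (G (α k t)) (Ici t) t := by
      intro k hk t ht
      have htk : t < k := ht.2.trans_le (by exact_mod_cast hk)
      refine (hα k t ⟨ht.1, htk.le⟩).mono_of_mem_nhdsWithin ?_
      exact mem_of_superset (Icc_mem_nhdsGE htk) (Icc_subset_Icc_left ht.1)
    exact ODE_solution_unique (v := fun _ => G) (fun _ => hG)
      (fun t ht => (hα m t ht).continuousWithinAt) (hright m le_rfl)
      (fun t ht => ((hα n t (hsub ht)).continuousWithinAt).mono hsub) (hright n hmn)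
      (by rw [hα0, hα0])
  have hglue : ∀ (n : ℕ) (t : ℝ), 0 ≤ t → t < n → α (⌊t⌋₊ + 1) t = α n t := by
    intro n t ht htn
    have hle : ⌊t⌋₊ + 1 ≤ n := Nat.succ_le_of_lt ((Nat.floor_lt ht).2 htn)
    refine heq _ _ hle ⟨ht, ?_⟩
    push_cast
    exact (Nat.lt_floor_add_one t).le
  -- The index `⌊t⌋₊ + 1` is strictly larger than `t`.
  refine ⟨fun t => α (⌊t⌋₊ + 1) t, fun t ht => ?_, hα0 _⟩
  obtain ⟨n, hn⟩ := exists_nat_gt t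
  have hnhds : Icc (0 : ℝ) n ∩ Iio (n : ℝ) ∈ 𝓝[Ici 0] t := by
    have : Iio (n : ℝ) ∩ Ici 0 ∈ 𝓝[Ici 0] t :=
      inter_mem (mem_nhdsWithin_of_mem_nhds (Iio_mem_nhds hn)) self_mem_nhdsWithin
    exact mem_of_superset this fun u hu => ⟨⟨hu.2, le_of_lt hu.1⟩, hu.1⟩
  have hd : HasDerivWithinAt (α n) (G (α n t)) (Ici 0) t :=
    (hα n t ⟨ht, hn.le⟩).mono_of_mem_nhdsWithin (mem_of_superset hnhds inter_subset_left)
  simp only [hglue n t ht hn]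
  refine hd.congr_of_eventuallyEq ?_ (hglue n t ht hn)
  filter_upwards [hnhds] with u hu using hglue n u hu.1.1 hu.2

/-- If `V` does not increase along a `C¹` vector field on a bounded strict sublevel set, then every
point of this set is the initial value of a global trajectory. -/
theorem exists_isTrajectory_of_sublevel {F : ℝ × ℝ → ℝ × ℝ} (hF : ContDiff ℝ 1 F)
    {V : ℝ × ℝ → ℝ} (hV : Differentiable ℝ V) {r R : ℝ} (hR : 0 ≤ R)
    (hbdd : ∀ p, V p < r → |p.1| ≤ R ∧ |p.2| ≤ R)
    (hdec : ∀ p, V p < r → orbitalDeriv F V p ≤ 0) {x₀ : ℝ × ℝ} (h0 : V x₀ < r) :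
    ∃ x, IsTrajectory F x ∧ x 0 = x₀ := by
  have hRR : -R ≤ R := by linarith
  set B : Set (ℝ × ℝ) := Icc (-R) R ×ˢ Icc (-R) R with hB
  have hBc : IsCompact B := isCompact_Icc.prod isCompact_Icc
  obtain ⟨K, hK⟩ := hF.contDiffOn.exists_lipschitzOnWith (s := B) one_ne_zero
    ((convex_Icc _ _).prod (convex_Icc _ _)) hBc
  obtain ⟨C, hC⟩ := hBc.exists_bound_of_continuousOn hF.continuous.continuousOn
  -- Retraction onto the square: `F ∘ c` is bounded and Lipschitz and agrees with `F` on `{V < r}`,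
  -- which its trajectories from `x₀` never leave.
  set c : ℝ × ℝ → ℝ × ℝ := fun p => (projIcc (-R) R hRR p.1, projIcc (-R) R hRR p.2) with hc
  have hcB : ∀ p, c p ∈ B := fun p => ⟨Subtype.coe_prop _, Subtype.coe_prop _⟩
  have hcLip : LipschitzWith 1 c := by
    have h1 : LipschitzWith (1 * (1 * 1)) fun p : ℝ × ℝ => (projIcc (-R) R hRR p.1 : ℝ) :=
      (LipschitzWith.subtype_val _).comp ((LipschitzWith.projIcc hRR).comp LipschitzWith.prod_fst)
    have h2 : LipschitzWith (1 * (1 * 1)) fun p : ℝ × ℝ => (projIcc (-R) R hRR p.2 : ℝ) :=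
      (LipschitzWith.subtype_val _).comp ((LipschitzWith.projIcc hRR).comp LipschitzWith.prod_snd)
    simpa using h1.prodMk h2
  have hceq : ∀ p, V p < r → c p = p := by
    intro p hp
    obtain ⟨h1, h2⟩ := hbdd p hp
    simp only [hc, projIcc_of_mem hRR (abs_le.1 h1), projIcc_of_mem hRR (abs_le.1 h2)]
  have hGLip : LipschitzWith (K * 1) (F ∘ c) :=
    lipschitzOnWith_univ.1 (hK.comp hcLip.lipschitzOnWith fun p _ => hcB p)
  have hGb : ∀ p, ‖(F ∘ c) p‖ ≤ (C.toNNReal : ℝ≥0) := fun p =>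
    (hC _ (hcB p)).trans (Real.le_coe_toNNReal C)
  obtain ⟨x, hx, hx0⟩ := exists_isTrajectory_of_lipschitzWith hGLip hGb x₀
  refine ⟨x, fun t ht => ?_, hx0⟩
  have hlt : V (x t) < r := hx.lt_of_orbitalDeriv_nonpos hV
    (fun p hp => by
      have := hdec p hp
      rwa [orbitalDeriv, Function.comp_apply, hceq p hp])
    (by rwa [hx0]) ht
  simpa [hceq _ hlt] using hx t ht

/-! ### Convergence of derivatives -/

/-- **Barbalat's lemma**: if `f` converges and its derivative is uniformly continuous, then the
derivative tends to zero. -/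
theorem tendsto_zero_of_hasDerivWithinAt_of_uniformContinuousOn {f h : ℝ → ℝ} {c : ℝ}
    (hf : ∀ t, 0 ≤ t → HasDerivWithinAt f (h t) (Ici 0) t) (hlim : Tendsto f atTop (𝓝 c))
    (hu : UniformContinuousOn h (Ici 0)) : Tendsto h atTop (𝓝 0) := by
  rw [Metric.tendsto_nhds]
  intro ε hε
  obtain ⟨δ, hδ, hδu⟩ := Metric.uniformContinuousOn_iff.1 hu (ε / 2) (half_pos hε)
  have hd : 0 < δ / 2 := half_pos hδ
  have hdiff : Tendsto (fun t => f (t + δ / 2) - f t) atTop (𝓝 0) := by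
    simpa using (hlim.comp (tendsto_atTop_add_const_right _ (δ / 2) tendsto_id)).sub hlim
  filter_upwards [eventually_ge_atTop 0,
    (Metric.tendsto_nhds.1 hdiff) (ε / 2 * (δ / 2)) (by positivity)] with t ht hsmall
  have hsub : Icc t (t + δ / 2) ⊆ Ici 0 := fun u hu => ht.trans hu.1
  -- On a window of length `δ / 2`, `f` stays close to the line of slope `h t`; a small increment of
  -- `f` then forces a small slope.
  have hmv := (convex_Icc t (t + δ / 2)).norm_image_sub_le_of_norm_hasDerivWithin_le
    (f := fun u => f u - h t * u) (f' := fun u => h u - h t) (C := ε / 2)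
    (fun u hu => by
      simpa using ((hf u (hsub hu)).mono hsub).fun_sub
        ((hasDerivWithinAt_id u _).const_mul (h t)))
    (fun u hu => by
      have hdist : dist u t < δ := by
        rw [Real.dist_eq, abs_of_nonneg (by linarith [hu.1])]
        linarith [hu.2]
      exact (hδu u (hsub hu) t ht hdist).le)
    (left_mem_Icc.2 (by linarith)) (right_mem_Icc.2 (by linarith))
  rw [Real.dist_eq, sub_zero] at hsmall ⊢
  rw [Real.norm_eq_abs, Real.norm_eq_abs, add_sub_cancel_left, abs_of_pos hd] at hmv
  have hkey : |h t| * (δ / 2) < ε * (δ / 2) := by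
    have e : h t * (δ / 2) = (f (t + δ / 2) - f t)
        - (f (t + δ / 2) - h t * (t + δ / 2) - (f t - h t * t)) := by ring
    calc |h t| * (δ / 2) = |h t * (δ / 2)| := by rw [abs_mul, abs_of_pos hd]
      _ ≤ |f (t + δ / 2) - f t|
          + |f (t + δ / 2) - h t * (t + δ / 2) - (f t - h t * t)| := by
        rw [e]; exact abs_sub _ _
      _ < ε * (δ / 2) := by linarith
  exact lt_of_mul_lt_mul_right hkey hd.le

/-- If `V` converges along a trajectory in a compact set, then its orbital derivative tends to
zero along the trajectory. -/
theorem IsTrajectory.tendsto_orbitalDeriv {F : ℝ × ℝ → ℝ × ℝ} (hF : Continuous F)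
    {x : ℝ → ℝ × ℝ} (hx : IsTrajectory F x) {K : Set (ℝ × ℝ)} (hK : IsCompact K)
    (hxK : ∀ t, 0 ≤ t → x t ∈ K) {V : ℝ × ℝ → ℝ} (hV : ContDiff ℝ 1 V) {c : ℝ}
    (hlim : Tendsto (fun t => V (x t)) atTop (𝓝 c)) :
    Tendsto (fun t => orbitalDeriv F V (x t)) atTop (𝓝 0) := by
  obtain ⟨C, hC⟩ := hK.exists_bound_of_continuousOn hF.continuousOn
  -- Bounded velocity makes `x` Lipschitz, which supplies the uniform continuity in Barbalat's
  -- lemma.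
  have hlip : LipschitzOnWith C.toNNReal x (Ici 0) :=
    (convex_Ici 0).lipschitzOnWith_of_nnnorm_hasDerivWithin_le (fun t ht => hx t ht)
      fun t ht => NNReal.coe_le_coe.1 ((hC _ (hxK t ht)).trans (Real.le_coe_toNNReal C))
  have hcont : Continuous (orbitalDeriv F V) :=
    (hV.continuous_fderiv one_ne_zero).clm_apply hF
  exact tendsto_zero_of_hasDerivWithinAt_of_uniformContinuousOn
    (fun t ht => hx.hasDerivWithinAt_comp (hV.differentiable one_ne_zero) ht) hlim
    ((hK.uniformContinuousOn_of_continuous hcont.continuousOn).comp hlip.uniformContinuousOn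
      fun t ht => hxK t ht)

/-! ### Cluster points -/

theorem eq_of_mapClusterPt_of_tendsto {X Y ι : Type*} [TopologicalSpace X] [TopologicalSpace Y]
    [T2Space Y] {l : Filter ι} {x : ι → X} {φ : X → Y} {z : X} {c : Y}
    (hz : MapClusterPt z l x) (hφ : ContinuousAt φ z)
    (h : Tendsto (fun t => φ (x t)) l (𝓝 c)) : φ z = c :=
  t2_iff_nhds.1 ‹_› ((hz.continuousAt_comp hφ).clusterPt.mono h)

/-- Otherwise the curve is frequently in a compact set where `φ` avoids a neighbourhood of `c`, and
it clusters there. -/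
theorem tendsto_of_forall_mapClusterPt {X Y ι : Type*} [TopologicalSpace X] [TopologicalSpace Y]
    {l : Filter ι} {x : ι → X} {K : Set X} (hK : IsCompact K) (hx : ∀ᶠ t in l, x t ∈ K)
    {φ : X → Y} (hφ : Continuous φ) {c : Y} (h : ∀ z, MapClusterPt z l x → φ z = c) :
    Tendsto (fun t => φ (x t)) l (𝓝 c) := by
  refine tendsto_nhds.2 fun U hU hcU => ?_
  by_contra hnot
  have hfreq : ∃ᶠ t in l, x t ∈ K ∩ (φ ⁻¹' U)ᶜ :=
    ((not_eventually.1 hnot).and_eventually hx).mono fun t ht => ⟨ht.2, ht.1⟩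
  obtain ⟨z, hz, hzc⟩ := (hK.inter_right
    (hU.preimage hφ).isClosed_compl).exists_mapClusterPt_of_frequently hfreq
  exact hz.2 (show φ z ∈ U by rw [h z hzc]; exact hcU)

/-- A continuous curve in a compact set converges if it has only finitely many cluster points. -/
theorem exists_tendsto_of_finite_mapClusterPt {X : Type*} [MetricSpace X] {x : ℝ → X}
    (hc : ContinuousOn x (Ici 0)) {K : Set X} (hK : IsCompact K) (hx : ∀ t, 0 ≤ t → x t ∈ K)
    {S : Set X} (hS : S.Finite) (h : ∀ z, MapClusterPt z atTop x → z ∈ S) :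
    ∃ z ∈ S, Tendsto x atTop (𝓝 z) := by
  have hev : ∀ᶠ t in atTop, x t ∈ K := (eventually_ge_atTop 0).mono hx
  obtain ⟨z, -, hz⟩ := hK.exists_mapClusterPt_of_frequently hev.frequently
  refine ⟨z, h z hz, ?_⟩
  obtain ⟨ρ, hρ, hρS⟩ : ∃ ρ > 0, ∀ w ∈ S, w ≠ z → ρ < dist w z := by
    have hopen : (S \ {z})ᶜ ∈ 𝓝 z :=
      (hS.subset sdiff_subset).isClosed.isOpen_compl.mem_nhds (by simp)
    obtain ⟨ρ, hρ, hball⟩ := Metric.mem_nhds_iff.1 hopen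
    refine ⟨ρ / 2, half_pos hρ, fun w hw hwz => ?_⟩
    by_contra hlt
    exact hball (show dist w z < ρ by linarith) ⟨hw, hwz⟩
  rw [Metric.tendsto_nhds]
  intro ε hε
  set η := min ε ρ with hη
  have hηpos : 0 < η := lt_min hε hρ
  suffices hlt : ∀ᶠ t in atTop, dist (x t) z < η from
    hlt.mono fun t ht => ht.trans_le (min_le_left _ _)
  by_contra hnot
  have hin : ∃ᶠ t in atTop, dist (x t) z < η := hz.frequently (Metric.ball_mem_nhds z hηpos)
  have hout : ∃ᶠ t in atTop, η ≤ dist (x t) z :=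
    (not_eventually.1 hnot).mono fun t ht => not_lt.1 ht
  -- A curve that keeps entering and leaving the ball crosses its sphere at arbitrarily late times;
  -- a cluster point on the sphere is too close to `z` to be in `S`.
  have hsph : ∃ᶠ t in atTop, x t ∈ K ∩ Metric.sphere z η := by
    rw [frequently_atTop]
    intro T
    obtain ⟨t₁, ht₁, h₁⟩ := (frequently_atTop.1 hin) (max T 0)
    obtain ⟨t₂, ht₂, h₂⟩ := (frequently_atTop.1 hout) t₁
    have h0 : 0 ≤ t₁ := (le_max_right _ _).trans ht₁
    have hcd : ContinuousOn (fun t => dist (x t) z) (Icc t₁ t₂) :=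
      
      (continuous_id.dist continuous_const).comp_continuousOn (hc.mono fun t ht => h0.trans ht.1)
    obtain ⟨t, ht, hteq⟩ := intermediate_value_Icc ht₂ hcd ⟨h₁.le, h₂⟩
    exact ⟨t, ((le_max_left _ _).trans ht₁).trans ht.1, hx t (h0.trans ht.1), hteq⟩
  obtain ⟨w, hw, hwc⟩ :=
    (hK.inter_right Metric.isClosed_sphere).exists_mapClusterPt_of_frequently hsph
  have hdist : dist w z = η := hw.2
  have hne : w ≠ z := by
    rintro rfl
    rw [dist_self] at hdist
    linarith
  linarith [hρS w (h w hwc) hne, min_le_right ε ρ]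

/-! ### The class of systems -/

theorem contDiff_field (b₁ b₂ b₃ b₄ : ℝ) (s m q : ℕ) :
    ContDiff ℝ 1 (field b₁ b₂ b₃ b₄ s m q) := by
  unfold field
  fun_prop

theorem contDiff_energy (b₁ b₃ : ℝ) (s : ℕ) : ContDiff ℝ 1 (energy b₁ b₃ s) := by
  unfold energy
  fun_prop

/-- The conservative terms cancel, leaving only the damping. -/
theorem orbitalDeriv_energy (b₁ b₂ b₃ b₄ : ℝ) (s m q : ℕ) (x : ℝ × ℝ) :
    orbitalDeriv (field b₁ b₂ b₃ b₄ s m q) (energy b₁ b₃ s) x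
      = x.2 ^ 2 * (b₂ + b₄ * x.1 ^ (2 * m) * x.2 ^ (2 * q)) := by
  have hfst : HasFDerivAt (fun y : ℝ × ℝ => y.1) (ContinuousLinearMap.fst ℝ ℝ ℝ) x :=
    hasFDerivAt_fst
  have hsnd : HasFDerivAt (fun y : ℝ × ℝ => y.2) (ContinuousLinearMap.snd ℝ ℝ ℝ) x :=
    hasFDerivAt_snd
  have hE : HasFDerivAt (energy b₁ b₃ s) _ x :=
    (((hsnd.pow 2).const_mul (1 / 2)).sub ((hfst.pow 2).const_mul (b₁ / 2))).add
      ((hfst.pow (2 * s + 2)).const_mul (b₃ / (2 * s + 2)))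
  have hs : (2 * (s : ℝ) + 2) ≠ 0 := by positivity
  rw [orbitalDeriv, hE.fderiv]
  simp [field]
  field_simp
  ring

theorem orbitalDeriv_fst_mul_snd (F : ℝ × ℝ → ℝ × ℝ) (x : ℝ × ℝ) :
    orbitalDeriv F (fun y => y.1 * y.2) x = (F x).1 * x.2 + x.1 * (F x).2 := by
  have hfst : HasFDerivAt (fun y : ℝ × ℝ => y.1) (ContinuousLinearMap.fst ℝ ℝ ℝ) x :=
    hasFDerivAt_fst
  have hsnd : HasFDerivAt (fun y : ℝ × ℝ => y.2) (ContinuousLinearMap.snd ℝ ℝ ℝ) x :=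
    hasFDerivAt_snd
  have h : HasFDerivAt (fun y : ℝ × ℝ => y.1 * y.2) _ x := hfst.mul hsnd
  rw [orbitalDeriv, h.fderiv]
  simp
  ring

theorem isOpen_Omega (b₂ b₄ : ℝ) (m q : ℕ) : IsOpen (Omega b₂ b₄ m q) :=
  isOpen_lt (by fun_prop) continuous_const

theorem isOpen_sublevel (b₁ b₃ : ℝ) (s : ℕ) (r : ℝ) : IsOpen (sublevel b₁ b₃ s r) :=
  isOpen_lt (contDiff_energy b₁ b₃ s).continuous continuous_const

/-- Sublevel sets of the energy are bounded. -/
theorem exists_abs_le_of_energy_lt {b₁ b₃ : ℝ} {s : ℕ} (hb₃ : 0 < b₃) (hs : 1 ≤ s) (r : ℝ) :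
    ∃ R : ℝ, 0 ≤ R ∧ ∀ x : ℝ × ℝ, energy b₁ b₃ s x < r → |x.1| ≤ R ∧ |x.2| ≤ R := by
  set c : ℝ := b₃ / (2 * s + 2) with hc
  have hcpos : 0 < c := by positivity
  -- With `u = x₁²`, this `d` absorbs `c u` from `hpow` and `b₁ / 2 * u` from the energy, leaving
  -- one spare `u`.
  set d : ℝ := c + b₁ / 2 + 1 with hd
  set M : ℝ := |r| + d ^ 2 / (4 * c) with hM
  have hM0 : 0 ≤ M := by positivity
  -- Both squares are at most `2 M ≤ (2 M + 1)²`.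
  refine ⟨2 * M + 1, by linarith, fun x hx => ?_⟩
  have hpow : (x.1 ^ 2) ^ 2 - x.1 ^ 2 ≤ (x.1 ^ 2) ^ (s + 1) := by
    rcases le_total (x.1 ^ 2) 1 with h | h
    · have h0 : 0 ≤ (x.1 ^ 2) ^ (s + 1) := by positivity
      nlinarith [sq_nonneg x.1]
    · linarith [pow_le_pow_right₀ h (show 2 ≤ s + 1 by lia), sq_nonneg x.1]
  have hx' : 1 / 2 * x.2 ^ 2 - b₁ / 2 * x.1 ^ 2 + c * (x.1 ^ 2) ^ (s + 1) < r := by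
    rw [← pow_mul, show 2 * (s + 1) = 2 * s + 2 by ring]
    exact hx
  have hquad : d * x.1 ^ 2 ≤ c * (x.1 ^ 2) ^ 2 + d ^ 2 / (4 * c) := by
    have h0 : 0 ≤ (2 * c * x.1 ^ 2 - d) ^ 2 / (4 * c) := by positivity
    have e : (2 * c * x.1 ^ 2 - d) ^ 2 / (4 * c)
        = c * (x.1 ^ 2) ^ 2 - d * x.1 ^ 2 + d ^ 2 / (4 * c) := by
      field_simp
      ring
    linarith
  have hle : 1 / 2 * x.2 ^ 2 + x.1 ^ 2 ≤ M := by
    have h1 := mul_le_mul_of_nonneg_left hpow hcpos.le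
    have h2 : d * x.1 ^ 2 = c * x.1 ^ 2 + b₁ / 2 * x.1 ^ 2 + x.1 ^ 2 := by rw [hd]; ring
    have h3 := le_abs_self r
    linarith
  constructor <;> refine abs_le_of_sq_le_sq ?_ (by linarith) <;>
    nlinarith [sq_nonneg x.1, sq_nonneg x.2]

theorem finite_setOf_field_eq_zero {b₁ b₃ : ℝ} (b₂ b₄ : ℝ) {s : ℕ} (m q : ℕ)
    (hb₃ : 0 < b₃) (hs : 1 ≤ s) : {z | field b₁ b₂ b₃ b₄ s m q z = 0}.Finite := by
  have hroots : {a : ℝ | b₁ * a - b₃ * a ^ (2 * s + 1) = 0}.Finite := by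
    set p : Polynomial ℝ := Polynomial.C b₁ * Polynomial.X
      - Polynomial.C b₃ * Polynomial.X ^ (2 * s + 1) with hp
    have hp0 : p ≠ 0 := by
      intro h
      have hcoeff := congrArg (fun f => Polynomial.coeff f (2 * s + 1)) h
      simp [hp, Polynomial.coeff_C, show s ≠ 0 by lia] at hcoeff
      linarith
    refine (Polynomial.finite_setOfPred_isRoot hp0).subset fun a ha => ?_
    simpa [hp, Polynomial.IsRoot] using ha
  refine ((hroots.prod (finite_singleton (0 : ℝ)))).subset fun z hz => ?_
  have h2 : z.2 = 0 := congrArg Prod.fst hz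
  refine ⟨?_, h2⟩
  have h1 : b₁ * z.1 + b₂ * z.2
    + (-b₃ * z.1 ^ (2 * s + 1) + b₄ * z.1 ^ (2 * m) * z.2 ^ (2 * q + 1)) = 0 :=
    congrArg Prod.snd hz
  rw [h2, zero_pow (by lia)] at h1
  show b₁ * z.1 - b₃ * z.1 ^ (2 * s + 1) = 0
  linarith

theorem mem_isolatedEquilibria_of_finite {F : ℝ × ℝ → ℝ × ℝ} (hF : {z | F z = 0}.Finite)
    {z : ℝ × ℝ} (hz : F z = 0) : z ∈ isolatedEquilibria F := by
  refine ⟨hz, ?_⟩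
  have hopen : ({z | F z = 0} \ {z})ᶜ ∈ 𝓝 z :=
    (hF.subset sdiff_subset).isClosed.isOpen_compl.mem_nhds (by simp)
  filter_upwards [mem_nhdsWithin_of_mem_nhds hopen, self_mem_nhdsWithin] with y hy hyz h0
  exact hy ⟨h0, hyz⟩

/-- If the energy does not increase on an open set, then the damping factor is nonpositive there. -/
theorem damping_nonpos_of_isOpen {b₂ b₄ : ℝ} {m q : ℕ} {U : Set (ℝ × ℝ)} (hU : IsOpen U)
    (h : ∀ x ∈ U, x.2 ^ 2 * (b₂ + b₄ * x.1 ^ (2 * m) * x.2 ^ (2 * q)) ≤ 0) {x : ℝ × ℝ}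
    (hx : x ∈ U) : b₂ + b₄ * x.1 ^ (2 * m) * x.2 ^ (2 * q) ≤ 0 := by
  by_contra! hpos
  -- Moving `x₂` slightly keeps the factor positive and makes `x₂²` nonzero, so the case `x₂ = 0` is
  -- covered too.
  have hline : Continuous fun t : ℝ => (x.1, t) := by fun_prop
  have hg : Continuous fun t : ℝ => b₂ + b₄ * x.1 ^ (2 * m) * t ^ (2 * q) := by fun_prop
  have hev : ∀ᶠ t in 𝓝[≠] x.2, t ≠ 0 := by
    rcases eq_or_ne x.2 0 with h0 | h0
    · rw [h0]; exact self_mem_nhdsWithin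
    · exact mem_nhdsWithin_of_mem_nhds (isOpen_ne.mem_nhds h0)
  obtain ⟨t, ⟨htU, htpos⟩, ht0⟩ := ((((hline.tendsto x.2).eventually (hU.mem_nhds hx)).and
    ((hg.tendsto x.2).eventually (lt_mem_nhds hpos))).filter_mono nhdsWithin_le_nhds
      |>.and hev).exists
  have := h _ htU
  have h2 : 0 < t ^ 2 := by positivity
  exact absurd this (not_le.2 (mul_pos h2 htpos))

/-- If the damping factor is nonpositive on an open set, then there it vanishes only on the
coordinate axes. -/
theorem fst_mul_snd_eq_zero_of_damping_eq_zero {b₂ b₄ : ℝ} {m q : ℕ}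
    (hΩ : (Omega b₂ b₄ m q).Nonempty) {U : Set (ℝ × ℝ)} (hU : IsOpen U)
    (h : ∀ x ∈ U, b₂ + b₄ * x.1 ^ (2 * m) * x.2 ^ (2 * q) ≤ 0) {x : ℝ × ℝ} (hx : x ∈ U)
    (h0 : b₂ + b₄ * x.1 ^ (2 * m) * x.2 ^ (2 * q) = 0) : x.1 * x.2 = 0 := by
  by_contra hne
  obtain ⟨hx1, hx2⟩ := mul_ne_zero_iff.1 hne
  have hP : 0 < x.1 ^ (2 * m) * x.2 ^ (2 * q) := by
    rw [pow_mul, pow_mul]; positivity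
  -- The damping factor at `c • x`, as a function of `c`, is constant near `c = 1`.
  have hscale : ∀ c : ℝ, b₂ + b₄ * (c • x).1 ^ (2 * m) * (c • x).2 ^ (2 * q)
      = b₂ * (1 - c ^ (2 * m + 2 * q)) := by
    intro c
    have e : b₂ + b₄ * (c • x).1 ^ (2 * m) * (c • x).2 ^ (2 * q)
        = b₂ + c ^ (2 * m + 2 * q) * (b₄ * x.1 ^ (2 * m) * x.2 ^ (2 * q)) := by
      simp only [Prod.smul_fst, Prod.smul_snd, smul_eq_mul, mul_pow, pow_add]
      ring
    rw [e, show b₄ * x.1 ^ (2 * m) * x.2 ^ (2 * q) = -b₂ by linarith]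
    ring
  have hc : Continuous fun c : ℝ => c • x := by fun_prop
  have hev : ∀ᶠ c in 𝓝 (1 : ℝ), c • x ∈ U ∧ 0 < c :=
    ((hc.tendsto 1).eventually (hU.mem_nhds (by simpa using hx))).and (lt_mem_nhds one_pos)
  -- Otherwise `b₂ (1 - c^(2m+2q))` changes sign at `c = 1`. In either remaining case the trace
  -- vanishes identically, so `Omega` would be empty.
  have key : b₂ = 0 ∨ 2 * m + 2 * q = 0 := by
    by_contra! hcon
    obtain ⟨hb, hn⟩ := hcon
    rcases lt_or_gt_of_ne hb with hb | hb
    · obtain ⟨c, ⟨hcU, hc0⟩, hc1⟩ := ((hev.filter_mono nhdsWithin_le_nhds).and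
        (self_mem_nhdsWithin (s := Ioi (1 : ℝ)))).exists
      have h1 := h _ hcU
      rw [hscale] at h1
      have h2 : 1 < c ^ (2 * m + 2 * q) := one_lt_pow₀ hc1 hn
      nlinarith
    · obtain ⟨c, ⟨hcU, hc0⟩, hc1⟩ := ((hev.filter_mono nhdsWithin_le_nhds).and
        (self_mem_nhdsWithin (s := Iio (1 : ℝ)))).exists
      have h1 := h _ hcU
      rw [hscale] at h1
      have h2 : c ^ (2 * m + 2 * q) < 1 := pow_lt_one₀ hc0.le hc1 hn
      nlinarith
  obtain ⟨y, hy⟩ := hΩ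
  have hy' : b₂ + b₄ * (2 * q + 1) * y.1 ^ (2 * m) * y.2 ^ (2 * q) < 0 := hy
  rcases key with hb | hn
  · have hb4 : b₄ = 0 := by
      rw [hb, zero_add, mul_assoc] at h0
      exact (mul_eq_zero.1 h0).resolve_right hP.ne'
    simp [hb, hb4] at hy'
  · obtain ⟨rfl, rfl⟩ : m = 0 ∧ q = 0 := by lia
    simp at hy' h0
    linarith

/-- Every trajectory starting in an invariant sublevel set of the energy converges to an
equilibrium point, and the energy at the latter is less than `r`. -/
theorem exists_tendsto_equilibrium {b₁ b₂ b₃ b₄ : ℝ} {s m q : ℕ} (hb₃ : 0 < b₃) (hs : 1 ≤ s)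
    (hΩ : (Omega b₂ b₄ m q).Nonempty) {r : ℝ}
    (hE : ∀ x ∈ sublevel b₁ b₃ s r,
      orbitalDeriv (field b₁ b₂ b₃ b₄ s m q) (energy b₁ b₃ s) x ≤ 0)
    {x : ℝ → ℝ × ℝ} (hx : IsTrajectory (field b₁ b₂ b₃ b₄ s m q) x)
    (h0 : x 0 ∈ sublevel b₁ b₃ s r) :
    ∃ z, field b₁ b₂ b₃ b₄ s m q z = 0 ∧ z ∈ sublevel b₁ b₃ s r ∧ Tendsto x atTop (𝓝 z) := by
  set F := field b₁ b₂ b₃ b₄ s m q with hF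
  set V := energy b₁ b₃ s with hV
  have hFc : Continuous F := (contDiff_field b₁ b₂ b₃ b₄ s m q).continuous
  have hVc : ContDiff ℝ 1 V := contDiff_energy b₁ b₃ s
  have hVd : Differentiable ℝ V := hVc.differentiable one_ne_zero
  have hlt : ∀ t, 0 ≤ t → V (x t) < r := fun t ht =>
    hx.lt_of_orbitalDeriv_nonpos hVd hE h0 ht
  have hanti : AntitoneOn (fun t => V (x t)) (Ici 0) :=
    hx.antitoneOn_of_orbitalDeriv_nonpos hVd fun t ht => hE _ (hlt t ht)
  obtain ⟨R, hR, hbdd⟩ := exists_abs_le_of_energy_lt (b₁ := b₁) hb₃ hs r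
  set B : Set (ℝ × ℝ) := Icc (-R) R ×ˢ Icc (-R) R with hB
  set K : Set (ℝ × ℝ) := B ∩ {p | V p ≤ V (x 0)} with hKdef
  have hK : IsCompact K :=
    (isCompact_Icc.prod isCompact_Icc).inter_right (isClosed_le hVc.continuous continuous_const)
  have hxK : ∀ t, 0 ≤ t → x t ∈ K := fun t ht =>
    ⟨⟨abs_le.1 (hbdd _ (hlt t ht)).1, abs_le.1 (hbdd _ (hlt t ht)).2⟩,
      hanti self_mem_Ici ht ht⟩
  have hKU : ∀ z ∈ K, z ∈ sublevel b₁ b₃ s r := fun z hz =>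
    show V z < r from lt_of_le_of_lt hz.2 h0
  have hcK : ∀ z, MapClusterPt z atTop x → z ∈ K := fun z hz =>
    hK.isClosed.mem_of_mapClusterPt hz ((eventually_ge_atTop 0).mono hxK)
  -- The energy converges, hence its orbital derivative tends to zero.
  obtain ⟨e, he⟩ : ∃ e, Tendsto (fun t => V (x t)) atTop (𝓝 e) := by
    obtain ⟨C, hC⟩ := hK.bddBelow_image hVc.continuous.continuousOn
    -- Freezing time at `0` extends monotonicity to all of `ℝ`.
    have hanti' : Antitone fun t => V (x (max t 0)) := fun t u htu =>
      hanti (mem_Ici.2 (le_max_right t 0)) (mem_Ici.2 (le_max_right u 0)) (max_le_max_right 0 htu)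
    refine ⟨_, (tendsto_atTop_ciInf hanti' ⟨C, ?_⟩).congr' ?_⟩
    · rintro _ ⟨t, rfl⟩
      exact hC ⟨_, hxK _ (le_max_right _ _), rfl⟩
    · filter_upwards [eventually_ge_atTop 0] with t ht
      rw [max_eq_left ht]
  have hdE := hx.tendsto_orbitalDeriv hFc hK hxK hVc he
  have hcontE : Continuous (orbitalDeriv F V) := (hVc.continuous_fderiv one_ne_zero).clm_apply hFc
  have hdamp : ∀ z ∈ sublevel b₁ b₃ s r, b₂ + b₄ * z.1 ^ (2 * m) * z.2 ^ (2 * q) ≤ 0 :=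
    fun z hz => damping_nonpos_of_isOpen (isOpen_sublevel b₁ b₃ s r)
      (fun y hy => by rw [← orbitalDeriv_energy b₁ b₂ b₃ b₄ s m q]; exact hE y hy) hz
  have haxes : ∀ z, MapClusterPt z atTop x → z.1 * z.2 = 0 := by
    intro z hz
    have hzero := eq_of_mapClusterPt_of_tendsto hz hcontE.continuousAt hdE
    rw [hF, hV, orbitalDeriv_energy] at hzero
    rcases mul_eq_zero.1 hzero with h | h
    · rw [pow_eq_zero_iff two_ne_zero] at h
      rw [h, mul_zero]
    · exact fst_mul_snd_eq_zero_of_damping_eq_zero hΩ (isOpen_sublevel b₁ b₃ s r) hdamp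
        (hKU z (hcK z hz)) h
  -- Hence `x₁ x₂` converges as well, and so does its orbital derivative.
  have hWc : ContDiff ℝ 1 fun p : ℝ × ℝ => p.1 * p.2 := by fun_prop
  have hdW := hx.tendsto_orbitalDeriv hFc hK hxK hWc
    (tendsto_of_forall_mapClusterPt hK ((eventually_ge_atTop 0).mono hxK) hWc.continuous haxes)
  have hcontW : Continuous (orbitalDeriv F fun p : ℝ × ℝ => p.1 * p.2) :=
    (hWc.continuous_fderiv one_ne_zero).clm_apply hFc
  have heq : ∀ z, MapClusterPt z atTop x → F z = 0 := by
    intro z hz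
    have hzero := eq_of_mapClusterPt_of_tendsto hz hcontW.continuousAt hdW
    have hF1 : (F z).1 = z.2 := rfl
    rw [orbitalDeriv_fst_mul_snd, hF1] at hzero
    have hz2 : z.2 = 0 := by
      rcases mul_eq_zero.1 (haxes z hz) with h | h
      · rw [h, zero_mul, add_zero] at hzero
        exact mul_self_eq_zero.1 hzero
      · exact h
    refine Prod.ext (hF1.trans hz2) ?_
    rw [hz2, mul_zero, zero_add] at hzero
    -- Either `z` is the origin, an equilibrium, or the second component of `F z` vanishes.
    rcases mul_eq_zero.1 hzero with h | h
    · simp [hF, field, h, hz2]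
    · exact h
  obtain ⟨z, hz, hlim⟩ := exists_tendsto_of_finite_mapClusterPt hx.continuousOn hK hxK
    (finite_setOf_field_eq_zero b₂ b₄ m q hb₃ hs) heq
  exact ⟨z, hz, hKU z (hcK z hlim.mapClusterPt), hlim⟩

end PlanarBOA

theorem mainTheorem1 (b₁ b₂ b₃ b₄ : ℝ) (s m q : ℕ)
    (hb₁ : 0 < b₁) (hb₃ : 0 < b₃) (hs : 1 ≤ s)
    (hΩ : (PlanarBOA.Omega b₂ b₄ m q).Nonempty)
    (hC : ∃ γ : ℝ → ℝ × ℝ, PlanarBOA.IsSimpleClosedCurve γ ∧ PlanarBOA.IsCounterclockwise γ ∧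
      PlanarBOA.HasIndex (PlanarBOA.field b₁ b₂ b₃ b₄ s m q) γ 1)
    (r : ℝ)
    (hE : ∀ x ∈ PlanarBOA.sublevel b₁ b₃ s r,
      PlanarBOA.orbitalDeriv (PlanarBOA.field b₁ b₂ b₃ b₄ s m q)
        (PlanarBOA.energy b₁ b₃ s) x ≤ 0) :
    IsOpen (PlanarBOA.Omega b₂ b₄ m q ∩ PlanarBOA.sublevel b₁ b₃ s r) ∧
    PlanarBOA.ConvergesFrom (PlanarBOA.field b₁ b₂ b₃ b₄ s m q)
      (PlanarBOA.Omega b₂ b₄ m q ∩ PlanarBOA.sublevel b₁ b₃ s r)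
      (PlanarBOA.isolatedEquilibria (PlanarBOA.field b₁ b₂ b₃ b₄ s m q)) ∧
    ((∀ z : ℝ × ℝ, PlanarBOA.field b₁ b₂ b₃ b₄ s m q z = 0 →
        z ∉ PlanarBOA.OmegaZero b₂ b₄ m q) →
      PlanarBOA.IsCommonBOA (PlanarBOA.field b₁ b₂ b₃ b₄ s m q)
        (PlanarBOA.Omega b₂ b₄ m q ∩ PlanarBOA.sublevel b₁ b₃ s r)) := by
  open PlanarBOA in
  have hopen : IsOpen (Omega b₂ b₄ m q ∩ sublevel b₁ b₃ s r) :=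
    (isOpen_Omega b₂ b₄ m q).inter (isOpen_sublevel b₁ b₃ s r)
  have hex : ∀ x₀ ∈ Omega b₂ b₄ m q ∩ sublevel b₁ b₃ s r,
      ∃ x, IsTrajectory (field b₁ b₂ b₃ b₄ s m q) x ∧ x 0 = x₀ := by
    intro x₀ hx₀
    obtain ⟨R, hR, hbdd⟩ := exists_abs_le_of_energy_lt (b₁ := b₁) hb₃ hs r
    exact exists_isTrajectory_of_sublevel (contDiff_field b₁ b₂ b₃ b₄ s m q)
      ((contDiff_energy b₁ b₃ s).differentiable one_ne_zero) hR hbdd hE hx₀.2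
  have hiso : ∀ z, field b₁ b₂ b₃ b₄ s m q z = 0 →
      z ∈ isolatedEquilibria (field b₁ b₂ b₃ b₄ s m q) := fun z hz =>
    mem_isolatedEquilibria_of_finite (finite_setOf_field_eq_zero b₂ b₄ m q hb₃ hs) hz
  refine ⟨hopen, fun x₀ hx₀ => ⟨hex x₀ hx₀, fun x hx hx0 => ?_⟩,
    fun hΩ₀ => ⟨hopen, fun x₀ hx₀ => ⟨hex x₀ hx₀, fun x hx hx0 => ?_⟩⟩⟩
  · obtain ⟨z, hz, -, hlim⟩ := exists_tendsto_equilibrium hb₃ hs hΩ hE hx (hx0 ▸ hx₀.2)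
    exact ⟨z, hiso z hz, hlim⟩
  · obtain ⟨z, hz, hzU, hlim⟩ := exists_tendsto_equilibrium hb₃ hs hΩ hE hx (hx0 ▸ hx₀.2)
    refine ⟨z, ⟨hiso z hz, lt_of_le_of_ne ?_ (hΩ₀ z hz), hzU⟩, hlim⟩
    have hdamp := damping_nonpos_of_isOpen (isOpen_sublevel b₁ b₃ s r)
      (fun y hy => by rw [← orbitalDeriv_energy b₁ b₂ b₃ b₄ s m q]; exact hE y hy) hzU
    have hz2 : z.2 = 0 := congrArg Prod.fst hz
    -- On `x₂ = 0` trace and damping factor agree: for `q = 0` because `2q + 1 = 1`, for `q > 0`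
    -- because both equal `b₂`.
    rcases Nat.eq_zero_or_pos q with rfl | hq
    · simpa using hdamp
    · rw [hz2, zero_pow (by lia), mul_zero] at hdamp ⊢
      exact hdamp
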